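/- Let $(\xi,\eta)$ be a random vector whose components are arbitrarily dependent and almost surely positive, and let $(\xi_i,\eta_i)_{i\ge 1}$ be independent copies of $(\xi,\eta)$. Consider the perturbed random walk $T=(T_i)_{i\ge1}$, $T_i:=\xi_1+\cdots+\xi_{i-1}+\eta_i$, and the general branching process generated by $T$: there is one ancestor (generation $0$), born at time $0$; every individual produces a sequence of children, and the shifts of the children's birth times with respect to the birth time of their mother form a copy of $T$, the copies for different mothers being independent. For $j\in\{0,1,2,\ldots\}$ and $t\in\mathbb{R}$ let $N_j(t)$ be the number of individuals of generation $j$ with birth times $\le t$, and let $V_j(t):=\mathbb{E}N_j(t)$. Assume that $\mathbb{E}\xi^2<\infty$ and $\mathbb{E}\eta<\infty$, and put $m:=\mathbb{E}\xi$. Then $V_k(t)<\infty$ for all $k$ and $t$, and for every function $j=j(t)$ with values in $\{0,1,2,\ldots\}$ such that $j(t)=o(t^{1/2})$ as $t\to\infty$, $$V_{j(t)}(t)\sim\frac{t^{j(t)}}{m^{j(t)}\,j(t)!},\qquad t\to\infty,$$ that is, the ratio of the two sides tends to $1$. -/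

import Mathlib

open MeasureTheory ProbabilityTheory Filter Asymptotics
open scoped Topology ENNReal Nat

/-- The perturbed random walk `T` driven by the increments `x` and the perturbations `y`, with
indices shifted to start at `0`: the term of index `i` is `x 0 + ⋯ + x (i - 1) + y i`. -/
noncomputable def perturbedWalk (x y : ℕ → ℝ) (i : ℕ) : ℝ :=
  (∑ k ∈ Finset.range i, x k) + y i

/-- Birth times in a general branching process. Individuals are finite words of natural numbers:
`[]` is the ancestor, born at time `0`, and `i :: u` is the child of index `i` of the individual
`u`. The number `τ u i` is the shift of the birth time of `i :: u` with respect to that of `u`. -/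
noncomputable def birthTime (τ : List ℕ → ℕ → ℝ) : List ℕ → ℝ
  | [] => 0
  | i :: u => birthTime τ u + τ u i

/-- `N_j(t)`: the number of individuals of the `j`th generation with birth times `≤ t`. -/
noncomputable def generationCount (τ : List ℕ → ℕ → ℝ) (j : ℕ) (t : ℝ) : ℕ∞ :=
  Set.encard {u : List ℕ | u.length = j ∧ birthTime τ u ≤ t}

/-- `V_j(t) = 𝔼 N_j(t)`, as an extended nonnegative number, for a random family of shifts `τ`. -/
noncomputable def meanGenerationCount {Ω : Type*} [MeasurableSpace Ω] (P : Measure Ω)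
    (τ : List ℕ → ℕ → Ω → ℝ) (j : ℕ) (t : ℝ) : ℝ≥0∞ :=
  ∫⁻ ω, (generationCount (fun u i => τ u i ω) j t : ℝ≥0∞) ∂P

/-! Everything rests on a two-sided linear bound for the renewal function `U` of the walk with steps
`ξ`. Stop the walk when it first exceeds `t`: by Wald's identity `m U(t)` is `t` plus the mean
overshoot. The overshoot is nonnegative, and its mean is bounded in `t` because `𝔼ξ²` is finite
(`exists_mul_tsum_measure_partialSum_le`). The perturbation `η` costs at most `𝔼η` in the lower
bound, so `(t - b)⁺ ≤ m V_1(t) ≤ (t + c)⁺` (`exists_walkMean_bounds`).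

Conditioning on the mothers' birth times makes `V_{k+1}` the convolution of `V_k` with `V_1`. The
linear bounds therefore give `∫_{-∞}^{t-b} V_k ≤ m V_{k+1}(t) ≤ ∫_{-∞}^{t+c} V_k`, and induction
traps `V_k(t)` between `((t - kb)⁺)^k / (m^k k!)` and `((t + kc)⁺)^k / (m^k k!)`. After division by
`t^j / (m^j j!)` the bounds differ from `1` by an error governed by `j²/t`, which tends to `0`
exactly when `j = o(t^{1/2})`. -/

/-! ### Linear bounds for the renewal function. -/

section Renewal

/-- The random walk with increments `X`, started at `0`. -/
def partialSum {Ω : Type*} (X : ℕ → Ω → ℝ) (n : ℕ) (ω : Ω) : ℝ := ∑ k ∈ Finset.range n, X k ω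

theorem partialSum_succ {Ω : Type*} (X : ℕ → Ω → ℝ) (n : ℕ) (ω : Ω) :
    partialSum X (n + 1) ω = partialSum X n ω + X n ω := Finset.sum_range_succ _ _

variable {Ω : Type*} [MeasurableSpace Ω] {P : Measure Ω}

theorem aemeasurable_partialSum {X : ℕ → Ω → ℝ} (hX : ∀ n, AEMeasurable (X n) P) (n : ℕ) :
    AEMeasurable (partialSum X n) P := by
  unfold partialSum
  exact Finset.aemeasurable_fun_sum _ fun i _ => hX i

theorem lintegral_indicator_mul_of_indepFun {β γ : Type*} [MeasurableSpace β] [MeasurableSpace γ]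
    {X : Ω → β} {Y Y' : Ω → γ} (hX : AEMeasurable X P) (h : IndepFun X Y P)
    (hY : IdentDistrib Y Y' P P) {B : Set β} (hB : MeasurableSet B) {f : γ → ℝ≥0∞}
    (hf : Measurable f) :
    ∫⁻ ω, B.indicator 1 (X ω) * f (Y ω) ∂P = P (X ⁻¹' B) * ∫⁻ ω, f (Y' ω) ∂P := by
  have hB1 : Measurable (B.indicator (1 : β → ℝ≥0∞)) := measurable_one.indicator hB
  have h1 := lintegral_mul_eq_lintegral_mul_lintegral_of_indepFun''
    (hB1.comp_aemeasurable hX) (hf.comp_aemeasurable hY.aemeasurable_fst) (h.comp hB1 hf)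
  simp only [Function.comp_apply] at h1
  have h2 : ∫⁻ ω, f (Y ω) ∂P = ∫⁻ ω, f (Y' ω) ∂P := (hY.comp hf).lintegral_eq
  rw [h1, h2]
  congr 1
  have : (fun ω => B.indicator (1 : β → ℝ≥0∞) (X ω)) = (X ⁻¹' B).indicator 1 := rfl
  rw [this, lintegral_indicator_one₀ (hX.nullMeasurableSet_preimage hB)]

/-- Wald's identity, truncated at `N`: whether step `n` starts at or below `t` is decided by the
earlier steps. -/
theorem lintegral_sum_indicator_partialSum_mul {X : ℕ → Ω → ℝ} {ξ : Ω → ℝ}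
    (hind : ∀ n, IndepFun (partialSum X n) (X n) P) (hid : ∀ n, IdentDistrib (X n) ξ P P)
    (t : ℝ) (N : ℕ) :
    ∫⁻ ω, ∑ n ∈ Finset.range N, (Set.Iic t).indicator 1 (partialSum X n ω)
        * ENNReal.ofReal (X n ω) ∂P =
      (∑ n ∈ Finset.range N, P (partialSum X n ⁻¹' Set.Iic t))
        * ∫⁻ ω, ENNReal.ofReal (ξ ω) ∂P := by
  have hX := fun n => (hid n).aemeasurable_fst
  have hm := aemeasurable_partialSum hX
  have hmeas : ∀ n ∈ Finset.range N, AEMeasurable (fun ω =>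
      (Set.Iic t).indicator (1 : ℝ → ℝ≥0∞) (partialSum X n ω) * ENNReal.ofReal (X n ω)) P :=
    fun n _ => ((measurable_one.indicator measurableSet_Iic).comp_aemeasurable (hm n)).mul
      (hX n).ennreal_ofReal
  rw [lintegral_finsetSum' _ hmeas, Finset.sum_mul]
  exact Finset.sum_congr rfl fun n _ => lintegral_indicator_mul_of_indepFun (hm n) (hind n)
    (hid n) measurableSet_Iic ENNReal.measurable_ofReal

/-- The expected number of visits of a random walk with nonnegative increments to an interval of
length `a` is at most `1 / P(ξ > a)`. -/
theorem tsum_measure_partialSum_mem_Ioc_mul_le [IsProbabilityMeasure P] {X : ℕ → Ω → ℝ} {ξ : Ω → ℝ}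
    (hpos : ∀ᵐ ω ∂P, ∀ n, 0 ≤ X n ω) (hind : ∀ n, IndepFun (partialSum X n) (X n) P)
    (hid : ∀ n, IdentDistrib (X n) ξ P P) (a t : ℝ) :
    (∑' n, P (partialSum X n ⁻¹' Set.Ioc (t - a) t)) * P (ξ ⁻¹' Set.Ioi a) ≤ 1 := by
  have hm := aemeasurable_partialSum fun n => (hid n).aemeasurable_fst
  -- A jump longer than `a` from `(t - a, t]` leaves `(-∞, t]`, so these jumps are paid for by the
  -- decrease of `P(S_n ≤ t)`, which telescopes.
  have hstep : ∀ n, P (partialSum X n ⁻¹' Set.Ioc (t - a) t) * P (ξ ⁻¹' Set.Ioi a)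
      + P (partialSum X (n + 1) ⁻¹' Set.Iic t) ≤ P (partialSum X n ⁻¹' Set.Iic t) := by
    intro n
    have h1 : P (partialSum X n ⁻¹' Set.Ioc (t - a) t) * P (ξ ⁻¹' Set.Ioi a)
        = P (partialSum X n ⁻¹' Set.Ioc (t - a) t ∩ X n ⁻¹' Set.Ioi a) := by
      rw [(hind n).measure_inter_preimage_eq_mul _ _ measurableSet_Ioc measurableSet_Ioi,
        (hid n).measure_preimage_eq measurableSet_Ioi]
    rw [h1, ← measure_union₀ ((hm (n + 1)).nullMeasurableSet_preimage measurableSet_Iic)]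
    · refine measure_mono_ae ?_
      filter_upwards [hpos] with ω hω h
      rcases h with h | h
      · exact h.1.2
      · have h2 : partialSum X (n + 1) ω ≤ t := h
        rw [partialSum_succ] at h2
        exact le_trans (by linarith [hω n]) h2
    · refine Disjoint.aedisjoint (Set.disjoint_left.2 fun ω h h' => ?_)
      have h2 : partialSum X (n + 1) ω ≤ t := h'
      rw [partialSum_succ] at h2
      have h3 : t - a < partialSum X n ω := h.1.1
      have h4 : a < X n ω := h.2
      linarith
  rw [← ENNReal.tsum_mul_right]
  refine ENNReal.tsum_le_of_sum_range_le fun N => ?_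
  have : ∀ N, ∑ n ∈ Finset.range N, P (partialSum X n ⁻¹' Set.Ioc (t - a) t) * P (ξ ⁻¹' Set.Ioi a)
      + P (partialSum X N ⁻¹' Set.Iic t) ≤ 1 := by
    intro N
    induction N with
    | zero => simpa using prob_le_one
    | succ N ih =>
      rw [Finset.sum_range_succ, add_assoc]
      exact le_trans (by gcongr; exact hstep N) ih
  exact le_trans le_self_add (this N)

/-- The steps started at or below `t` add up to at most `t` plus the overshoot, and only the
crossing step has `x n > t - s n`. -/
theorem sum_ofReal_mul_indicator_le {x s : ℕ → ℝ} (hs0 : s 0 = 0) (hs : ∀ n, s (n + 1) = s n + x n)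
    (hx : ∀ n, 0 ≤ x n) {t : ℝ} (ht : 0 ≤ t) (N : ℕ) :
    ∑ n ∈ Finset.range N, (Set.Iic t).indicator 1 (s n) * ENNReal.ofReal (x n) ≤
      ENNReal.ofReal t + ∑ n ∈ Finset.range N,
        (Set.Iic t).indicator 1 (s n) * ENNReal.ofReal (x n - (t - s n)) := by
  -- With `min (s N) t` in place of `t` the bound survives induction, as it records how far the walk
  -- has come.
  suffices h : ∑ n ∈ Finset.range N, (Set.Iic t).indicator 1 (s n) * ENNReal.ofReal (x n) ≤
      ENNReal.ofReal (min (s N) t) + ∑ n ∈ Finset.range N,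
        (Set.Iic t).indicator 1 (s n) * ENNReal.ofReal (x n - (t - s n)) from
    h.trans (by gcongr; exact min_le_right _ _)
  have hs' : ∀ n, 0 ≤ s n := fun n => by
    induction n with
    | zero => exact hs0.ge
    | succ n ih => rw [hs]; linarith [hx n]
  induction N with
  | zero => simp
  | succ N ih =>
    rw [Finset.sum_range_succ, Finset.sum_range_succ]
    have key : ENNReal.ofReal (min (s N) t) + (Set.Iic t).indicator 1 (s N) * ENNReal.ofReal (x N)
        ≤ ENNReal.ofReal (min (s (N + 1)) t) +
          (Set.Iic t).indicator 1 (s N) * ENNReal.ofReal (x N - (t - s N)) := by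
      by_cases h : s N ≤ t
      · simp only [Set.indicator, Set.mem_Iic, h, if_true, Pi.one_apply, one_mul]
        rw [min_eq_left h, ← ENNReal.ofReal_add (hs' N) (hx N), ← hs]
        rcases le_total (s (N + 1)) t with h2 | h2
        · rw [min_eq_left h2]; exact le_self_add
        · rw [min_eq_right h2, ← ENNReal.ofReal_add ht (by rw [hs] at h2; linarith)]
          exact ENNReal.ofReal_le_ofReal (by rw [hs]; linarith)
      · simp only [Set.indicator, Set.mem_Iic, h, if_false, zero_mul, add_zero]
        refine ENNReal.ofReal_le_ofReal (min_le_min_right _ ?_)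
        rw [hs]; linarith [hx N]
    refine (add_le_add_left ih _).trans ?_
    rw [add_right_comm, add_comm (Finset.sum _ _) (_ * _), ← add_assoc]
    exact add_le_add_left key _

theorem ofReal_min_le_sum_indicator {x s : ℕ → ℝ} (hs0 : s 0 = 0)
    (hs : ∀ n, s (n + 1) = s n + x n) (t : ℝ) (N : ℕ) :
    ENNReal.ofReal (min (s N) t) ≤
      ∑ n ∈ Finset.range N, (Set.Iic t).indicator 1 (s n) * ENNReal.ofReal (x n) := by
  induction N with
  | zero => simp [hs0]
  | succ N ih =>
    rw [Finset.sum_range_succ]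
    by_cases h : s N ≤ t
    · simp only [Set.indicator, Set.mem_Iic, h, if_true, Pi.one_apply, one_mul]
      rw [min_eq_left h] at ih
      calc _ ≤ ENNReal.ofReal (s N + x N) := ENNReal.ofReal_le_ofReal (by rw [hs]; simp)
        _ ≤ _ := ENNReal.ofReal_add_le
        _ ≤ _ := by gcongr; exact ih
    · simp only [Set.indicator, Set.mem_Iic, h, if_false, zero_mul, add_zero]
      refine le_trans (ENNReal.ofReal_le_ofReal ?_) ih
      rw [min_eq_right (not_le.1 h).le]; exact min_le_right _ _

/-- Lower bound of the renewal function. -/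
theorem ofReal_le_mul_tsum_measure_partialSum_le [IsProbabilityMeasure P] {X : ℕ → Ω → ℝ}
    {ξ : Ω → ℝ} (hind : ∀ n, IndepFun (partialSum X n) (X n) P)
    (hid : ∀ n, IdentDistrib (X n) ξ P P) (hξ : ∫⁻ ω, ENNReal.ofReal (ξ ω) ∂P ≠ 0) (t : ℝ) :
    ENNReal.ofReal t ≤
      (∫⁻ ω, ENNReal.ofReal (ξ ω) ∂P) * ∑' n, P (partialSum X n ⁻¹' Set.Iic t) := by
  have hX := fun n => (hid n).aemeasurable_fst
  have hm := aemeasurable_partialSum hX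
  by_cases htop : ∑' n, P (partialSum X n ⁻¹' Set.Iic t) = ∞
  · rw [htop, ENNReal.mul_top hξ]; exact le_top
  have hlim := ENNReal.tendsto_atTop_zero_of_tsum_ne_top htop
  have hfin : ∀ N, ENNReal.ofReal t * (1 - P (partialSum X N ⁻¹' Set.Iic t)) ≤
      (∫⁻ ω, ENNReal.ofReal (ξ ω) ∂P) * ∑' n, P (partialSum X n ⁻¹' Set.Iic t) := by
    intro N
    calc ENNReal.ofReal t * (1 - P (partialSum X N ⁻¹' Set.Iic t))
        = ∫⁻ ω, ENNReal.ofReal t * (partialSum X N ⁻¹' Set.Iic t)ᶜ.indicator 1 ω ∂P := by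
          have hn : NullMeasurableSet (partialSum X N ⁻¹' Set.Iic t) P :=
            (hm N).nullMeasurableSet_preimage measurableSet_Iic
          rw [lintegral_const_mul' _ _ ENNReal.ofReal_ne_top,
            lintegral_indicator_one₀ hn.compl, prob_compl_eq_one_sub₀ hn]
      _ ≤ ∫⁻ ω, ∑ n ∈ Finset.range N, (Set.Iic t).indicator 1 (partialSum X n ω)
            * ENNReal.ofReal (X n ω) ∂P := by
          refine lintegral_mono fun ω => ?_
          refine le_trans ?_ (ofReal_min_le_sum_indicator (s := fun n => partialSum X n ω)
            (by simp [partialSum]) (fun n => partialSum_succ X n ω) t N)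
          by_cases h : partialSum X N ω ≤ t
          · simp [Set.indicator, h]
          · simp [Set.indicator, h, min_eq_right (not_le.1 h).le]
      _ = (∑ n ∈ Finset.range N, P (partialSum X n ⁻¹' Set.Iic t))
            * ∫⁻ ω, ENNReal.ofReal (ξ ω) ∂P :=
          lintegral_sum_indicator_partialSum_mul hind hid t N
      _ ≤ _ := by
          rw [mul_comm]
          gcongr
          exact ENNReal.sum_le_tsum _
  have h := ENNReal.Tendsto.const_mul (a := ENNReal.ofReal t)
    (ENNReal.Tendsto.sub (tendsto_const_nhds (x := (1 : ℝ≥0∞))) hlim (Or.inl ENNReal.one_ne_top))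
    (Or.inr ENNReal.ofReal_ne_top)
  rw [tsub_zero, mul_one] at h
  exact le_of_tendsto' h hfin

theorem tsum_ofReal_sub_mul_le {a : ℝ} (ha : 0 < a) {x : ℝ} (hx : 0 ≤ x) :
    ∑' k : ℕ, ENNReal.ofReal (x - k * a) ≤ ENNReal.ofReal (x ^ 2 / a + x) := by
  rw [tsum_eq_sum (s := Finset.range ⌈x / a⌉₊)]
  · calc _ ≤ ∑ k ∈ Finset.range ⌈x / a⌉₊, ENNReal.ofReal x :=
          Finset.sum_le_sum fun k _ => ENNReal.ofReal_le_ofReal (by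
            have : 0 ≤ k * a := by positivity
            linarith)
      _ = ENNReal.ofReal (⌈x / a⌉₊ * x) := by
          rw [ENNReal.ofReal_mul (by positivity)]; simp
      _ ≤ _ := by
          refine ENNReal.ofReal_le_ofReal ?_
          have := (Nat.ceil_lt_add_one (show 0 ≤ x / a by positivity)).le
          calc _ ≤ (x / a + 1) * x := by gcongr
            _ = _ := by ring
  · intro k hk
    rw [Finset.mem_range, not_lt, Nat.ceil_le, div_le_iff₀ ha] at hk
    exact ENNReal.ofReal_of_nonpos (by linarith)

/-- Cut `(-∞, t]` into cells of length `a`: from the `k`th cell the distance to `t` is at least `k *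
a`. -/
theorem indicator_Iic_mul_ofReal_le {a : ℝ} (ha : 0 < a) (t s x : ℝ) :
    (Set.Iic t).indicator 1 s * ENNReal.ofReal (x - (t - s)) ≤
      ∑' k : ℕ, (Set.Ioc (t - k * a - a) (t - k * a)).indicator 1 s
        * ENNReal.ofReal (x - k * a) := by
  by_cases h : s ≤ t
  · refine le_trans ?_ (ENNReal.le_tsum ⌊(t - s) / a⌋₊)
    have h1 := Nat.floor_le (show 0 ≤ (t - s) / a from div_nonneg (by linarith) ha.le)
    have h2 := Nat.lt_floor_add_one ((t - s) / a)
    rw [le_div_iff₀ ha] at h1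
    rw [div_lt_iff₀ ha] at h2
    rw [Set.indicator_of_mem (by exact h), Set.indicator_of_mem (by constructor <;> linarith)]
    simp only [Pi.one_apply, one_mul]
    exact ENNReal.ofReal_le_ofReal (by linarith)
  · simp [Set.indicator, h]

/-- Upper bound of the renewal function. -/
theorem exists_mul_tsum_measure_partialSum_le [IsProbabilityMeasure P] {X : ℕ → Ω → ℝ}
    {ξ : Ω → ℝ} (hpos : ∀ᵐ ω ∂P, ∀ n, 0 ≤ X n ω) (hind : ∀ n, IndepFun (partialSum X n) (X n) P)
    (hid : ∀ n, IdentDistrib (X n) ξ P P) (hξ : ∀ᵐ ω ∂P, 0 < ξ ω)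
    (hξ_sq : Integrable (fun ω => ξ ω ^ 2) P) :
    ∃ C : ℝ, 0 ≤ C ∧ ∀ t, 0 ≤ t →
      (∫⁻ ω, ENNReal.ofReal (ξ ω) ∂P) * ∑' n, P (partialSum X n ⁻¹' Set.Iic t) ≤
        ENNReal.ofReal (t + C) := by
  have hX := fun n => (hid n).aemeasurable_fst
  have hm := aemeasurable_partialSum hX
  have hξm : AEMeasurable ξ P := (hid 0).aemeasurable_snd
  obtain ⟨a, ha, hPa⟩ : ∃ a : ℝ, 0 < a ∧ P (ξ ⁻¹' Set.Ioi a) ≠ 0 := by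
    by_contra! h
    have h1 : ∀ᵐ ω ∂P, ∀ n : ℕ, ξ ω ≤ 1 / ((n : ℝ) + 1) := by
      rw [ae_all_iff]
      intro n
      have := h (1 / ((n : ℝ) + 1)) (by positivity)
      rw [ae_iff]
      convert this using 2
      ext ω; simp
    obtain ⟨ω, h2, h3⟩ := (hξ.and h1).exists
    obtain ⟨n, hn⟩ := exists_nat_one_div_lt h2
    exact absurd (h3 n) (not_le.2 hn)
  have hL2 : MemLp ξ 2 P := (memLp_two_iff_integrable_sq hξm.aestronglyMeasurable).2 hξ_sq
  have hint : Integrable ξ P := hL2.integrable (by norm_num)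
  set q := P (ξ ⁻¹' Set.Ioi a) with hq
  -- `H * q⁻¹` bounds the mean overshoot: each cell has at most `1 / q` expected visits, whatever
  -- `t` is. The second moment makes `H` finite.
  set H := ∑' k : ℕ, ∫⁻ ω, ENNReal.ofReal (ξ ω - k * a) ∂P with hH
  have hHfin : H ≠ ∞ := by
    rw [hH, ← lintegral_tsum fun k => (hξm.sub_const _).ennreal_ofReal]
    refine ne_top_of_le_ne_top ?_ (lintegral_mono_ae
      (g := fun ω => ENNReal.ofReal (ξ ω ^ 2 / a + ξ ω)) ?_)
    · exact ((hξ_sq.div_const a).add hint).lintegral_lt_top.ne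
    · filter_upwards [hξ] with ω hω using tsum_ofReal_sub_mul_le ha hω.le
  have hC : H * q⁻¹ ≠ ∞ := ENNReal.mul_ne_top hHfin (ENNReal.inv_ne_top.2 hPa)
  refine ⟨(H * q⁻¹).toReal, ENNReal.toReal_nonneg, fun t ht => ?_⟩
  rw [ENNReal.ofReal_add ht ENNReal.toReal_nonneg, ENNReal.ofReal_toReal hC, mul_comm,
    ← ENNReal.tsum_mul_right]
  have hind1 : ∀ (B : Set ℝ), MeasurableSet B → ∀ n,
      AEMeasurable (fun ω => B.indicator (1 : ℝ → ℝ≥0∞) (partialSum X n ω)) P :=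
    fun B hB n => (measurable_one.indicator hB).comp_aemeasurable (hm n)
  refine ENNReal.tsum_le_of_sum_range_le fun N => ?_
  rw [← Finset.sum_mul, ← lintegral_sum_indicator_partialSum_mul hind hid]
  calc ∫⁻ ω, ∑ n ∈ Finset.range N, (Set.Iic t).indicator 1 (partialSum X n ω)
            * ENNReal.ofReal (X n ω) ∂P
      ≤ ∫⁻ ω, (ENNReal.ofReal t + ∑' n, ∑' k : ℕ,
          (Set.Ioc (t - k * a - a) (t - k * a)).indicator 1 (partialSum X n ω)
            * ENNReal.ofReal (X n ω - k * a)) ∂P := by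
        refine lintegral_mono_ae ?_
        filter_upwards [hpos] with ω hω
        refine (sum_ofReal_mul_indicator_le (s := fun n => partialSum X n ω)
            (by simp [partialSum]) (fun n => partialSum_succ X n ω) hω ht N).trans ?_
        gcongr
        refine le_trans ?_ (ENNReal.sum_le_tsum (Finset.range N))
        gcongr
        exact indicator_Iic_mul_ofReal_le ha _ _ _
    _ = ENNReal.ofReal t + ∑' n, ∑' k : ℕ,
          P (partialSum X n ⁻¹' Set.Ioc (t - k * a - a) (t - k * a))
            * ∫⁻ ω, ENNReal.ofReal (ξ ω - k * a) ∂P := by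
        rw [lintegral_add_left measurable_const]
        have hmk : ∀ n (k : ℕ), AEMeasurable (fun ω =>
          (Set.Ioc (t - k * a - a) (t - k * a)).indicator (1 : ℝ → ℝ≥0∞) (partialSum X n ω)
            * ENNReal.ofReal (X n ω - k * a)) P := fun n k =>
          (hind1 _ measurableSet_Ioc n).mul ((hX n).sub_const _).ennreal_ofReal
        rw [lintegral_tsum fun n => AEMeasurable.tsum (hmk n)]
        simp only [lintegral_const, measure_univ, mul_one]
        congr 1
        refine tsum_congr fun n => ?_
        rw [lintegral_tsum (hmk n)]
        exact tsum_congr fun k => lintegral_indicator_mul_of_indepFun (hm n) (hind n) (hid n)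
          measurableSet_Ioc (f := fun x => ENNReal.ofReal (x - k * a)) (by fun_prop)
    _ ≤ ENNReal.ofReal t + H * q⁻¹ := by
        gcongr
        rw [ENNReal.tsum_comm, hH, ← ENNReal.tsum_mul_right]
        refine ENNReal.tsum_le_tsum fun k => ?_
        rw [ENNReal.tsum_mul_right, mul_comm]
        gcongr
        rw [ENNReal.le_inv_iff_mul_le]
        exact tsum_measure_partialSum_mem_Ioc_mul_le hpos hind hid a _

end Renewal

/-! ### Linear bounds for the mean of the perturbed walk. -/

section PerturbedWalk

variable {Ω : Type*} [MeasurableSpace Ω] {P : Measure Ω}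

theorem measurable_measure_le_sub (X : Ω → ℝ) (t : ℝ) :
    Measurable fun y : ℝ => P {ω | X ω ≤ t - y} := by
  refine Antitone.measurable fun y z h => measure_mono fun ω hω => ?_
  simp only [Set.mem_ofPred_eq] at hω ⊢
  linarith

theorem measure_add_le_eq_lintegral [IsFiniteMeasure P] {X Y : Ω → ℝ} (hX : AEMeasurable X P)
    (hY : AEMeasurable Y P) (h : IndepFun X Y P) (t : ℝ) :
    P {ω | X ω + Y ω ≤ t} = ∫⁻ ω, P {ω' | Y ω' ≤ t - X ω} ∂P := by
  have hs : MeasurableSet {p : ℝ × ℝ | p.1 + p.2 ≤ t} :=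
    measurableSet_le (by fun_prop) measurable_const
  have h1 := Measure.map_apply_of_aemeasurable (hX.prodMk hY) hs
  rw [h.map_prod_eq_prod_map_map hX hY, Measure.prod_apply hs] at h1
  have h2 : ∀ x : ℝ, P.map Y (Prod.mk x ⁻¹' {p : ℝ × ℝ | p.1 + p.2 ≤ t})
      = P {ω' | Y ω' ≤ t - x} := fun x => by
    rw [Measure.map_apply_of_aemeasurable hY (measurable_prodMk_left hs)]
    congr 1
    ext ω
    simp only [Set.mem_preimage, Set.mem_ofPred_eq]
    constructor <;> intro h <;> linarith
  simp_rw [h2] at h1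
  rw [lintegral_map' (measurable_measure_le_sub Y t).aemeasurable hX] at h1
  exact h1.symm

/-- The expected number of points of the perturbed random walk in `(-∞, t]`. -/
noncomputable def walkMean (P : Measure Ω) (ξs ηs : ℕ → Ω → ℝ) (t : ℝ) : ℝ≥0∞ :=
  ∑' i, P {ω | perturbedWalk (fun k => ξs k ω) (fun k => ηs k ω) i ≤ t}

variable {ξ η : Ω → ℝ} {ξs ηs : ℕ → Ω → ℝ}

theorem indepFun_partialSum_of_iIndepFun_prod
    (h_indep : iIndepFun (fun i ω => (ξs i ω, ηs i ω)) P)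
    (hm : ∀ i, AEMeasurable (fun ω => (ξs i ω, ηs i ω)) P) (i : ℕ) :
    IndepFun (partialSum ξs i) (fun ω => (ξs i ω, ηs i ω)) P := by
  have h := h_indep.indepFun_finset₀ (Finset.range i) {i} (by simp) hm
  have hφ : Measurable fun f : Finset.range i → ℝ × ℝ => ∑ k, (f k).1 := by fun_prop
  have hψ : Measurable fun f : ({i} : Finset ℕ) → ℝ × ℝ => f ⟨i, by simp⟩ := by fun_prop
  have := h.comp hφ hψ
  convert! this using 1
  ext ω
  exact (Finset.sum_coe_sort (Finset.range i) fun k => ξs k ω).symm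

theorem exists_walkMean_bounds [IsProbabilityMeasure P]
    (hξ_pos : ∀ᵐ ω ∂P, 0 < ξ ω) (hη_pos : ∀ᵐ ω ∂P, 0 < η ω)
    (hξ_sq : Integrable (fun ω => ξ ω ^ 2) P) (hη_int : Integrable η P)
    (h_indep : iIndepFun (fun i ω => (ξs i ω, ηs i ω)) P)
    (h_copy : ∀ i, IdentDistrib (fun ω => (ξs i ω, ηs i ω)) (fun ω => (ξ ω, η ω)) P P) :
    0 < ∫ ω, ξ ω ∂P ∧ ∃ b c : ℝ, 0 ≤ b ∧ 0 ≤ c ∧ ∀ t : ℝ,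
      ENNReal.ofReal (t - b) ≤ ENNReal.ofReal (∫ ω, ξ ω ∂P) * walkMean P ξs ηs t ∧
      ENNReal.ofReal (∫ ω, ξ ω ∂P) * walkMean P ξs ηs t ≤ ENNReal.ofReal (t + c) := by
  have hpm : ∀ i, AEMeasurable (fun ω => (ξs i ω, ηs i ω)) P :=
    fun i => (h_copy i).aemeasurable_fst
  have hidξ : ∀ i, IdentDistrib (ξs i) ξ P P := fun i => (h_copy i).comp measurable_fst
  have hidη : ∀ i, IdentDistrib (ηs i) η P P := fun i => (h_copy i).comp measurable_snd
  have hindp := indepFun_partialSum_of_iIndepFun_prod h_indep hpm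
  have hindξ : ∀ i, IndepFun (partialSum ξs i) (ξs i) P :=
    fun i => (hindp i).comp measurable_id measurable_fst
  have hindη : ∀ i, IndepFun (partialSum ξs i) (ηs i) P :=
    fun i => (hindp i).comp measurable_id measurable_snd
  have hm := aemeasurable_partialSum fun i => (hidξ i).aemeasurable_fst
  have hposξ : ∀ᵐ ω ∂P, ∀ n, 0 < ξs n ω :=
    ae_all_iff.2 fun n => (hidξ n).symm.ae_mem_snd (measurableSet_Ioi (a := (0 : ℝ))) hξ_pos
  have hposη : ∀ᵐ ω ∂P, ∀ n, 0 < ηs n ω :=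
    ae_all_iff.2 fun n => (hidη n).symm.ae_mem_snd (measurableSet_Ioi (a := (0 : ℝ))) hη_pos
  have hposξ' : ∀ᵐ ω ∂P, ∀ n, 0 ≤ ξs n ω := hposξ.mono fun ω h n => (h n).le
  have hint : Integrable ξ P := ((memLp_two_iff_integrable_sq
    (hidξ 0).aemeasurable_snd.aestronglyMeasurable).2 hξ_sq).integrable (by norm_num)
  have hm0 : 0 < ∫ ω, ξ ω ∂P := by
    rw [integral_pos_iff_support_of_nonneg_ae (hξ_pos.mono fun ω h => h.le) hint]
    have : (Function.support ξ : Set Ω) =ᵐ[P] Set.univ :=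
      eventuallyEq_univ.2 (hξ_pos.mono fun ω h => h.ne')
    rw [measure_congr this]
    simp
  have hM : ENNReal.ofReal (∫ ω, ξ ω ∂P) = ∫⁻ ω, ENNReal.ofReal (ξ ω) ∂P :=
    ofReal_integral_eq_lintegral_ofReal hint (hξ_pos.mono fun ω h => h.le)
  obtain ⟨c, hc, hC⟩ := exists_mul_tsum_measure_partialSum_le hposξ' hindξ hidξ hξ_pos hξ_sq
  -- The lower bound averages the renewal bound at `t - η`, whence `b = 𝔼η`. The upper bound drops
  -- `η > 0`, so the renewal constant `c` is kept.
  refine ⟨hm0, ∫ ω, η ω ∂P, c, integral_nonneg_of_ae (hη_pos.mono fun ω h => h.le), hc,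
    fun t => ⟨?_, ?_⟩⟩
  · have h1 : ∀ i, P {ω | perturbedWalk (fun k => ξs k ω) (fun k => ηs k ω) i ≤ t} =
        ∫⁻ ω, P {ω' | partialSum ξs i ω' ≤ t - η ω} ∂P := fun i => by
      have h2 := measure_add_le_eq_lintegral (hidη i).aemeasurable_fst (hm i) (hindη i).symm t
      have h3 : ∫⁻ ω, P {ω' | partialSum ξs i ω' ≤ t - ηs i ω} ∂P
          = ∫⁻ ω, P {ω' | partialSum ξs i ω' ≤ t - η ω} ∂P :=
        ((hidη i).comp (measurable_measure_le_sub (partialSum ξs i) t)).lintegral_eq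
      rw [← h3, ← h2]
      simp only [perturbedWalk, partialSum, add_comm]
    have h4 : ∀ i, AEMeasurable (fun ω => P {ω' | partialSum ξs i ω' ≤ t - η ω}) P :=
      fun i => (measurable_measure_le_sub (partialSum ξs i) t).comp_aemeasurable
        (hidη i).aemeasurable_snd
    rw [walkMean, tsum_congr h1, ← lintegral_tsum h4, ← lintegral_const_mul'' _
      (AEMeasurable.tsum h4)]
    have hsub : Integrable (fun ω => t - η ω) P := (integrable_const t).sub hη_int
    calc ENNReal.ofReal (t - ∫ ω, η ω ∂P)
        ≤ ENNReal.ofReal (∫ ω, max (t - η ω) 0 ∂P) := by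
          refine ENNReal.ofReal_le_ofReal ?_
          have h5 : t - ∫ ω, η ω ∂P = ∫ ω, (t - η ω) ∂P := by
            rw [integral_sub (integrable_const t) hη_int]; simp
          rw [h5]
          exact integral_mono hsub hsub.pos_part fun ω => le_max_left _ _
      _ = ∫⁻ ω, ENNReal.ofReal (max (t - η ω) 0) ∂P :=
          ofReal_integral_eq_lintegral_ofReal hsub.pos_part
            (ae_of_all _ fun ω => le_max_right _ _)
      _ ≤ _ := by
          refine lintegral_mono fun ω => ?_
          have := ofReal_le_mul_tsum_measure_partialSum_le hindξ hidξ
            (by rw [← hM]; simpa using hm0) (t - η ω)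
          rw [hM]
          refine le_trans ?_ this
          simp [ENNReal.ofReal_max]
  · rcases lt_or_ge t 0 with ht | ht
    · have : walkMean P ξs ηs t = 0 := by
        refine ENNReal.tsum_eq_zero.2 fun i => ?_
        rw [measure_eq_zero_iff_ae_notMem]
        filter_upwards [hposξ', hposη] with ω h1 h2 h3
        have h4 : 0 ≤ ∑ k ∈ Finset.range i, ξs k ω := Finset.sum_nonneg fun k _ => h1 k
        have h5 : (∑ k ∈ Finset.range i, ξs k ω) + ηs i ω ≤ t := h3
        linarith [h2 i]
      simp [this]
    · refine le_trans ?_ (hC t ht)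
      rw [hM]
      gcongr
      refine ENNReal.tsum_le_tsum fun i => measure_mono_ae ?_
      filter_upwards [hposη] with ω h2 h3
      have h5 : (∑ k ∈ Finset.range i, ξs k ω) + ηs i ω ≤ t := h3
      exact le_trans (le_add_of_nonneg_right (h2 i).le) h5

end PerturbedWalk

/-! ### The recursion over generations. -/

section Branching

variable {Ω : Type*} [MeasurableSpace Ω] {P : Measure Ω}

/-- Only the shifts of strict ancestors, the proper suffixes of `u`, enter its birth time. This is
the source of the independence in `indepFun_birthTime`. -/
theorem birthTime_congr {σ τ : List ℕ → ℕ → ℝ} {u : List ℕ}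
    (h : ∀ v, v <:+ u → v ≠ u → σ v = τ v) : birthTime σ u = birthTime τ u := by
  induction u with
  | nil => rfl
  | cons i u ih =>
    rw [birthTime, birthTime, h u (List.suffix_cons i u) (by simp), ih]
    intro v hv hne
    refine h v (hv.trans (List.suffix_cons i u)) fun h' => ?_
    have := hv.length_le
    rw [h'] at this
    simp at this

theorem measurable_birthTime (u : List ℕ) :
    Measurable fun τ : List ℕ → ℕ → ℝ => birthTime τ u := by
  induction u with
  | nil => exact measurable_const
  | cons i u ih => exact ih.add (by fun_prop)

theorem indepFun_birthTime {τ : List ℕ → ℕ → Ω → ℝ}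
    (hτ_indep : iIndepFun (fun u ω => fun i => τ u i ω) P)
    (hτ : ∀ u, AEMeasurable (fun ω => fun i => τ u i ω) P) (u : List ℕ) (i : ℕ) :
    IndepFun (fun ω => birthTime (fun v k => τ v k ω) u) (τ u i) P := by
  classical
  set S : Finset (List ℕ) := u.tails.toFinset.erase u with hS
  have hext : Measurable fun (f : S → ℕ → ℝ) (v : List ℕ) =>
      if h : v ∈ S then f ⟨v, h⟩ else 0 := by
    refine measurable_pi_lambda _ fun v => ?_
    split_ifs
    · exact measurable_pi_apply _
    · exact measurable_const
  have hψ : Measurable fun f : ({u} : Finset (List ℕ)) → ℕ → ℝ => f ⟨u, by simp⟩ i := by fun_prop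
  have h := (hτ_indep.indepFun_finset₀ S {u} (by simp [hS]) hτ).comp
    ((measurable_birthTime u).comp hext) hψ
  convert! h using 1
  ext ω
  refine birthTime_congr fun v hv hne => ?_
  have hv' : v ∈ S := by simp [hS, hv, hne]
  simp [hv']

theorem aemeasurable_birthTime {τ : List ℕ → ℕ → Ω → ℝ}
    (hτ : ∀ u, AEMeasurable (fun ω => fun i => τ u i ω) P) (u : List ℕ) :
    AEMeasurable (fun ω => birthTime (fun v k => τ v k ω) u) P := by
  induction u with
  | nil => exact aemeasurable_const
  | cons i u ih => exact ih.add ((measurable_pi_apply i).comp_aemeasurable (hτ u))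

theorem generationCount_eq_tsum (τ : List ℕ → ℕ → ℝ) (j : ℕ) (t : ℝ) :
    (generationCount τ j t : ℝ≥0∞) = ∑' u : {u : List ℕ // u.length = j},
      {σ : List ℕ → ℕ → ℝ | birthTime σ u ≤ t}.indicator 1 τ := by
  rw [generationCount, ← ENNReal.tsum_set_one,
    tsum_subtype _ fun _ => (1 : ℝ≥0∞)]
  have := tsum_subtype {u : List ℕ | u.length = j}
    (fun u => {σ : List ℕ → ℕ → ℝ | birthTime σ u ≤ t}.indicator (1 : (List ℕ → ℕ → ℝ) → ℝ≥0∞) τ)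
  refine Eq.trans (tsum_congr fun u => ?_) this.symm
  by_cases h : u.length = j <;> by_cases h' : birthTime τ u ≤ t <;> simp [Set.indicator, h, h']

theorem meanGenerationCount_eq_tsum {τ : List ℕ → ℕ → Ω → ℝ}
    (hτ : ∀ u, AEMeasurable (fun ω => fun i => τ u i ω) P) (j : ℕ) (t : ℝ) :
    meanGenerationCount P τ j t = ∑' u : {u : List ℕ // u.length = j},
      P {ω | birthTime (fun v k => τ v k ω) u ≤ t} := by
  have hn : ∀ u : List ℕ, NullMeasurableSet {ω | birthTime (fun v k => τ v k ω) u ≤ t} P :=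
    fun u => (aemeasurable_birthTime hτ u).nullMeasurableSet_preimage measurableSet_Iic
  simp_rw [meanGenerationCount, generationCount_eq_tsum]
  have h1 : ∀ u : List ℕ, (fun ω => {σ : List ℕ → ℕ → ℝ | birthTime σ u ≤ t}.indicator
      (1 : (List ℕ → ℕ → ℝ) → ℝ≥0∞) (fun v k => τ v k ω)) =
      {ω | birthTime (fun v k => τ v k ω) u ≤ t}.indicator 1 := fun u => rfl
  rw [lintegral_tsum fun u => by
    rw [h1]; exact (aemeasurable_const (b := (1 : ℝ≥0∞))).indicator₀ (hn u)]
  refine tsum_congr fun u => ?_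
  rw [h1, lintegral_indicator_one₀ (hn u)]

/-- A word of length `j + 1` is a letter followed by a word of length `j`. -/
def wordSuccEquiv (j : ℕ) :
    {u : List ℕ // u.length = j} × ℕ ≃ {u : List ℕ // u.length = j + 1} where
  toFun p := ⟨p.2 :: p.1.1, by simp [p.1.2]⟩
  invFun u := (⟨u.1.tail, by simp [u.2]⟩, u.1.headI)
  left_inv p := rfl
  right_inv u := by
    obtain ⟨u, hu⟩ := u
    cases u with
    | nil => simp at hu
    | cons i u => rfl

theorem meanGenerationCount_succ [IsProbabilityMeasure P] {ξs ηs : ℕ → Ω → ℝ}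
    {τ : List ℕ → ℕ → Ω → ℝ}
    (hτ_indep : iIndepFun (fun u ω => fun i => τ u i ω) P)
    (hτ_copy : ∀ u, IdentDistrib (fun ω => fun i => τ u i ω)
      (fun ω => perturbedWalk (fun k => ξs k ω) (fun k => ηs k ω)) P P) (j : ℕ) (t : ℝ) :
    meanGenerationCount P τ (j + 1) t = ∑' u : {u : List ℕ // u.length = j},
      ∫⁻ ω, walkMean P ξs ηs (t - birthTime (fun v k => τ v k ω) u) ∂P := by
  have hτ := fun u => (hτ_copy u).aemeasurable_fst
  have hτi : ∀ u i, AEMeasurable (τ u i) P := fun u i =>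
    (measurable_pi_apply i).comp_aemeasurable (hτ u)
  rw [meanGenerationCount_eq_tsum hτ, ← (wordSuccEquiv j).tsum_eq]
  refine (ENNReal.tsum_prod (f := fun u i => P {ω | birthTime (fun v k => τ v k ω)
    (wordSuccEquiv j (u, i)) ≤ t})).trans ?_
  refine tsum_congr fun u => ?_
  have hb := aemeasurable_birthTime hτ u
  have h1 : ∀ i s, P {ω | τ u i ω ≤ s} =
      P {ω | perturbedWalk (fun k => ξs k ω) (fun k => ηs k ω) i ≤ s} := fun i s =>
    ((hτ_copy u).comp (measurable_pi_apply i)).measure_mem_eq measurableSet_Iic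
  simp_rw [walkMean, ← h1]
  have h2 : ∀ i, AEMeasurable (fun ω => P {ω' | τ u i ω' ≤
      t - birthTime (fun v k => τ v k ω) u}) P :=
    fun i => (measurable_measure_le_sub (τ u i) t).comp_aemeasurable hb
  rw [lintegral_tsum h2]
  refine tsum_congr fun i => ?_
  exact measure_add_le_eq_lintegral hb (hτi u i) (indepFun_birthTime hτ_indep hτ u i) t

/-- Tonelli, applied to `(x - X)⁺ = ∫_{-∞}^x 1{X ≤ s} ds`. -/
theorem lintegral_ofReal_sub_eq [SFinite P] {X : Ω → ℝ} (hX : AEMeasurable X P) (x : ℝ) :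
    ∫⁻ ω, ENNReal.ofReal (x - X ω) ∂P = ∫⁻ s in Set.Iic x, P {ω | X ω ≤ s} := by
  have hs : MeasurableSet {p : ℝ × ℝ | p.1 ≤ p.2} := measurableSet_le measurable_fst measurable_snd
  have h1 : ∀ s, P {ω | X ω ≤ s} =
      ∫⁻ y, {p : ℝ × ℝ | p.1 ≤ p.2}.indicator (1 : ℝ × ℝ → ℝ≥0∞) (y, s) ∂(P.map X) := fun s => by
    have : (fun y => {p : ℝ × ℝ | p.1 ≤ p.2}.indicator (1 : ℝ × ℝ → ℝ≥0∞) (y, s))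
        = (Set.Iic s).indicator 1 := rfl
    rw [this, lintegral_indicator_one measurableSet_Iic,
      Measure.map_apply_of_aemeasurable hX measurableSet_Iic]
    rfl
  simp_rw [h1]
  rw [lintegral_lintegral_swap (f := fun s y => {p : ℝ × ℝ | p.1 ≤ p.2}.indicator
      (1 : ℝ × ℝ → ℝ≥0∞) (y, s))
    ((measurable_one.indicator hs).comp measurable_swap).aemeasurable]
  have h2 : ∀ y, ∫⁻ s in Set.Iic x, {p : ℝ × ℝ | p.1 ≤ p.2}.indicator (1 : ℝ × ℝ → ℝ≥0∞) (y, s)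
      = ENNReal.ofReal (x - y) := fun y => by
    have : (fun s => {p : ℝ × ℝ | p.1 ≤ p.2}.indicator (1 : ℝ × ℝ → ℝ≥0∞) (y, s))
        = (Set.Ici y).indicator 1 := rfl
    rw [this, lintegral_indicator_one measurableSet_Ici,
      Measure.restrict_apply measurableSet_Ici, Set.Ici_inter_Iic, Real.volume_Icc]
  simp_rw [h2]
  rw [lintegral_map' (by fun_prop) hX]

theorem tsum_lintegral_ofReal_sub_birthTime [IsProbabilityMeasure P] {τ : List ℕ → ℕ → Ω → ℝ}
    (hτ : ∀ u, AEMeasurable (fun ω => fun i => τ u i ω) P) (j : ℕ) (x : ℝ) :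
    ∑' u : {u : List ℕ // u.length = j},
      ∫⁻ ω, ENNReal.ofReal (x - birthTime (fun v k => τ v k ω) u) ∂P =
    ∫⁻ s in Set.Iic x, meanGenerationCount P τ j s := by
  simp_rw [meanGenerationCount_eq_tsum hτ]
  have hmono : ∀ u, Monotone fun s => P {ω | birthTime (fun v k => τ v k ω) u ≤ s} :=
    fun u s s' h => measure_mono fun ω hω => le_trans hω h
  rw [lintegral_tsum fun u : {u : List ℕ // u.length = j} => (hmono u).measurable.aemeasurable]
  exact tsum_congr fun u => lintegral_ofReal_sub_eq (aemeasurable_birthTime hτ u) x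

end Branching

/-! ### Explicit bounds and their asymptotics. -/

section Growth

/-- The `j`-fold convolution power at `t` of Lebesgue measure on `[-d, ∞)` divided by `m`. -/
noncomputable def shiftedPower (m d : ℝ) (j : ℕ) (t : ℝ) : ℝ≥0∞ :=
  (Set.Ici 0).indicator (fun x => ENNReal.ofReal (x ^ j / (m ^ j * j !))) (t + j * d)

theorem setLIntegral_shiftedPower {m : ℝ} (hm : 0 < m) (d : ℝ) (j : ℕ) (t : ℝ) :
    ∫⁻ s in Set.Iic (t + d), shiftedPower m d j s =
      ENNReal.ofReal m * shiftedPower m d (j + 1) t := by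
  have h1 : (fun s => shiftedPower m d j s) = (Set.Ici (-(j * d))).indicator
      (fun s => ENNReal.ofReal ((s + j * d) ^ j / (m ^ j * j !))) := by
    ext s
    by_cases h : 0 ≤ s + j * d
    · rw [shiftedPower, Set.indicator_of_mem (by exact h),
        Set.indicator_of_mem (by simp only [Set.mem_Ici]; linarith)]
    · rw [shiftedPower, Set.indicator_of_notMem (by exact h),
        Set.indicator_of_notMem (by simp only [Set.mem_Ici]; linarith)]
  rw [h1, lintegral_indicator measurableSet_Ici, Measure.restrict_restrict measurableSet_Ici,
    Set.Ici_inter_Iic, shiftedPower]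
  push_cast
  by_cases h : 0 ≤ t + (j + 1) * d
  · have hle : -(j * d) ≤ t + d := by linarith
    rw [Set.indicator_of_mem (by exact h), ← ENNReal.ofReal_mul hm.le,
      ← ofReal_integral_eq_lintegral_ofReal]
    · rw [integral_Icc_eq_integral_Ioc, ← intervalIntegral.integral_of_le hle,
        intervalIntegral.integral_comp_add_right (fun x => x ^ j / (m ^ j * j !)),
        intervalIntegral.integral_div, integral_pow]
      congr 1
      have : ((j + 1)! : ℝ) = (j + 1) * j ! := by rw [Nat.factorial_succ]; push_cast; ring
      rw [this, neg_add_cancel, show t + d + j * d = t + (j + 1) * d by ring, pow_succ m]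
      have := hm.ne'
      have : (j ! : ℝ) ≠ 0 := by positivity
      have : (j + 1 : ℝ) ≠ 0 := by positivity
      field_simp
      simp
    · exact (Continuous.continuousOn (by fun_prop)).integrableOn_Icc
    · refine (ae_restrict_iff' measurableSet_Icc).2 (ae_of_all _ fun s hs => ?_)
      have : 0 ≤ s + j * d := by linarith [hs.1]
      simp only [Pi.zero_apply]
      positivity
  · rw [Set.indicator_of_notMem (by exact h), Set.Icc_eq_empty (by linarith)]
    simp

theorem tendsto_one_add_div_pow {j : ℝ → ℕ}
    (hj : (fun t : ℝ => (j t : ℝ)) =o[atTop] (fun t : ℝ => t ^ (1 / 2 : ℝ))) (d : ℝ) :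
    Tendsto (fun t => 1 + d * ((j t : ℝ) ^ 2 / t)) atTop (𝓝 1) ∧
    Tendsto (fun t => Real.exp (d * ((j t : ℝ) ^ 2 / t))) atTop (𝓝 1) := by
  have h1 : Tendsto (fun t => (j t : ℝ) ^ 2 / t) atTop (𝓝 0) := by
    have h := (hj.tendsto_div_nhds_zero).pow 2
    rw [zero_pow two_ne_zero] at h
    refine h.congr' ?_
    filter_upwards [eventually_ge_atTop 0] with t ht
    rw [div_pow, ← Real.sqrt_eq_rpow, Real.sq_sqrt ht]
  have h2 := h1.const_mul d
  rw [mul_zero] at h2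
  exact ⟨by simpa using h2.const_add 1, by simpa using h2.rexp⟩

end Growth

/-! ### The two-sided induction and the squeeze. -/

theorem corollary2p2 {Ω : Type*} [MeasurableSpace Ω] (P : Measure Ω) [IsProbabilityMeasure P]
    -- the generic vector `(ξ, η)`, with positive components and the moment conditions
    (ξ η : Ω → ℝ)
    (hξ_pos : ∀ᵐ ω ∂P, 0 < ξ ω) (hη_pos : ∀ᵐ ω ∂P, 0 < η ω)
    (hξ_sq : Integrable (fun ω => ξ ω ^ 2) P) (hη_int : Integrable η P)
    -- independent copies of `(ξ, η)`, which drive the perturbed random walk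
    (ξs ηs : ℕ → Ω → ℝ)
    (h_indep : iIndepFun (fun i ω => (ξs i ω, ηs i ω)) P)
    (h_copy : ∀ i, IdentDistrib (fun ω => (ξs i ω, ηs i ω)) (fun ω => (ξ ω, η ω)) P P)
    -- the shifts of the birth times: independent copies of the perturbed random walk, one copy
    -- for each individual
    (τ : List ℕ → ℕ → Ω → ℝ)
    (hτ_indep : iIndepFun (fun u ω => fun i => τ u i ω) P)
    (hτ_copy : ∀ u, IdentDistrib (fun ω => fun i => τ u i ω)
      (fun ω => perturbedWalk (fun k => ξs k ω) (fun k => ηs k ω)) P P)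
    (j : ℝ → ℕ)
    (hj : (fun t : ℝ => (j t : ℝ)) =o[atTop] (fun t : ℝ => t ^ (1 / 2 : ℝ))) :
    (∀ (k : ℕ) (t : ℝ), meanGenerationCount P τ k t ≠ ∞) ∧
    Tendsto (fun t : ℝ => (meanGenerationCount P τ (j t) t).toReal /
        (t ^ j t / ((∫ ω, ξ ω ∂P) ^ j t * (j t)!)))
      atTop (𝓝 1) := by
  obtain ⟨hm, b, c, hb, hc, hbd⟩ :=
    exists_walkMean_bounds hξ_pos hη_pos hξ_sq hη_int h_indep h_copy
  set m := ∫ ω, ξ ω ∂P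
  have hτ := fun u => (hτ_copy u).aemeasurable_fst
  have hM0 : ENNReal.ofReal m ≠ 0 := by simpa using hm
  -- At `j = 0` the shift `j * d` vanishes, so one base case serves both inductions.
  have hV0 : ∀ t d, meanGenerationCount P τ 0 t = shiftedPower m d 0 t := fun t d => by
    rw [meanGenerationCount_eq_tsum hτ, tsum_eq_single (⟨[], rfl⟩ : {u : List ℕ // u.length = 0})
      fun u hu => absurd (Subtype.ext (List.length_eq_zero_iff.1 u.2)) hu]
    by_cases h : 0 ≤ t <;> simp [birthTime, shiftedPower, Set.indicator, h]
  have hrec : ∀ k t, ENNReal.ofReal m * meanGenerationCount P τ (k + 1) t =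
      ∑' u : {u : List ℕ // u.length = k}, ∫⁻ ω, ENNReal.ofReal m *
        walkMean P ξs ηs (t - birthTime (fun v k => τ v k ω) u) ∂P := fun k t => by
    rw [meanGenerationCount_succ hτ_indep hτ_copy, ← ENNReal.tsum_mul_left]
    exact tsum_congr fun u => (lintegral_const_mul' _ _ ENNReal.ofReal_ne_top).symm
  have hup : ∀ k t, meanGenerationCount P τ k t ≤ shiftedPower m c k t := by
    intro k
    induction k with
    | zero => exact fun t => (hV0 t c).le
    | succ k ih =>
      intro t
      rw [← ENNReal.mul_le_mul_iff_right hM0 ENNReal.ofReal_ne_top, hrec,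
        ← setLIntegral_shiftedPower hm]
      refine le_trans ?_ (lintegral_mono fun s => ih s)
      rw [← tsum_lintegral_ofReal_sub_birthTime hτ]
      refine ENNReal.tsum_le_tsum fun u => lintegral_mono fun ω => ?_
      refine (hbd _).2.trans (ENNReal.ofReal_le_ofReal (by linarith))
  have hlow : ∀ k t, shiftedPower m (-b) k t ≤ meanGenerationCount P τ k t := by
    intro k
    induction k with
    | zero => exact fun t => (hV0 t (-b)).ge
    | succ k ih =>
      intro t
      rw [← ENNReal.mul_le_mul_iff_right hM0 ENNReal.ofReal_ne_top, hrec,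
        ← setLIntegral_shiftedPower hm]
      refine le_trans (lintegral_mono fun s => ih s) ?_
      rw [← tsum_lintegral_ofReal_sub_birthTime hτ]
      refine ENNReal.tsum_le_tsum fun u => lintegral_mono fun ω => ?_
      refine le_trans (ENNReal.ofReal_le_ofReal (by linarith)) (hbd _).1
  have hfin : ∀ k t, meanGenerationCount P τ k t ≠ ∞ := fun k t => by
    refine ne_top_of_le_ne_top ?_ (hup k t)
    unfold shiftedPower Set.indicator
    split_ifs <;> simp
  refine ⟨hfin, tendsto_of_tendsto_of_tendsto_of_le_of_le' (tendsto_one_add_div_pow hj (-b)).1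
    (tendsto_one_add_div_pow hj c).2 ?_ ?_⟩
  · filter_upwards [eventually_gt_atTop 0] with t ht
    rw [le_div_iff₀ (by positivity)]
    by_cases h : 0 ≤ t + j t * -b
    · have h1 := hlow (j t) t
      rw [shiftedPower, Set.indicator_of_mem (by exact h),
        ENNReal.ofReal_le_iff_le_toReal (hfin _ _)] at h1
      refine le_trans ?_ h1
      rw [← mul_div_assoc]
      refine div_le_div_of_nonneg_right ?_ (by positivity)
      have h2 : t + j t * -b = (1 + j t * -b / t) * t := by field_simp
      have h3 : 0 ≤ 1 + j t * -b / t := nonneg_of_mul_nonneg_left (h2 ▸ h) ht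
      rw [h2, mul_pow]
      gcongr
      -- Bernoulli's inequality; its base is nonnegative by `h3`.
      calc 1 + -b * ((j t : ℝ) ^ 2 / t) = 1 + j t * (j t * -b / t) := by ring
        _ ≤ _ := one_add_mul_le_pow (by linarith) _
    -- If `t < j b`, then `j ≥ 1` and `b j² / t ≥ 1`, so the claimed lower bound is nonpositive.
    · refine le_trans ?_ ENNReal.toReal_nonneg
      refine mul_nonpos_of_nonpos_of_nonneg ?_ (by positivity)
      push Not at h
      have hj1 : (1 : ℝ) ≤ j t := by
        rcases Nat.eq_zero_or_pos (j t) with h0 | h0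
        · rw [h0] at h; norm_num at h; linarith
        · exact_mod_cast h0
      have h4 : t ≤ b * (j t : ℝ) ^ 2 := by nlinarith [mul_nonneg hb (by linarith : (0:ℝ) ≤ j t)]
      have h5 : 1 ≤ b * (j t : ℝ) ^ 2 / t := by rwa [le_div_iff₀ ht, one_mul]
      have h6 : -b * ((j t : ℝ) ^ 2 / t) = -(b * (j t : ℝ) ^ 2 / t) := by ring
      linarith
  · filter_upwards [eventually_gt_atTop 0] with t ht
    rw [div_le_iff₀ (by positivity)]
    have h : 0 ≤ t + j t * c := by positivity
    have h1 := hup (j t) t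
    rw [shiftedPower, Set.indicator_of_mem (by exact h)] at h1
    refine (ENNReal.toReal_le_of_le_ofReal (by positivity) h1).trans ?_
    rw [← mul_div_assoc]
    refine div_le_div_of_nonneg_right ?_ (by positivity)
    have h2 : t + j t * c = (1 + j t * c / t) * t := by field_simp
    rw [h2, mul_pow]
    gcongr
    calc (1 + j t * c / t) ^ j t ≤ Real.exp (j t * c / t) ^ j t := by
          gcongr
          linarith [Real.add_one_le_exp (j t * c / t)]
      _ = _ := by rw [← Real.exp_nat_mul]; congr 1; ring
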